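/- Permutations $\sigma\in S_n$ are written in one-line notation $\sigma=\sigma_1\cdots\sigma_n$. Let $\mathrm{des}(\sigma)=|\{i:1\le i<n,\ \sigma_i>\sigma_{i+1}\}|$ and $\mathrm{inv}(\sigma)=|\{(i,j):1\le i<j\le n,\ \sigma_i>\sigma_j\}|$. For a word $w$ of $m$ distinct integers, $\mathrm{red}(w)\in S_m$ is obtained by replacing the $i$-th smallest letter of $w$ by $i$ for each $i$. For $\tau\in S_p$ and $\sigma\in S_n$, a $\tau$-match in $\sigma$ is a position $i$ with $1\le i\le n-p+1$ and $\mathrm{red}(\sigma_i\sigma_{i+1}\cdots\sigma_{i+p-1})=\tau$; let $\tau\text{-mch}(\sigma)$ be the number of $\tau$-matches in $\sigma$. A permutation $\tau\in S_p$ with $p\ge 3$ is minimal overlapping if the smallest $n$ such that some $\sigma\in S_n$ has $\tau\text{-mch}(\sigma)=2$ is $2p-1$. Permutations $\alpha,\beta\in S_p$ are mutually minimal overlapping if both are minimal overlapping and the smallest $n$ such that some $\sigma\in S_n$ has $\alpha\text{-mch}(\sigma)\ge1$ and $\beta\text{-mch}(\sigma)\ge1$ is $2p-1$. For $\Gamma\subseteq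 S_p$ let $\mathcal{NM}_n(\Gamma)$ be the set of $\sigma\in S_n$ that have no $\tau$-match for any $\tau\in\Gamma$. Let $q,z$ be indeterminates over $\mathbb{Q}$, let $[n]_q=1+q+\cdots+q^{n-1}$, $[n]_q!=[1]_q[2]_q\cdots[n]_q$, and $\begin{bmatrix}n\\k\end{bmatrix}_q=\frac{[n]_q!}{[k]_q!\,[n-k]_q!}$ for $0\le k\le n$. Let $$\mathrm{INM}_\Gamma(t,q,z)=1+\sum_{n\ge1}\frac{t^n}{[n]_q!}\sum_{\sigma\in\mathcal{NM}_n(\Gamma)}z^{\mathrm{des}(\sigma)+1}q^{\mathrm{inv}(\sigma)}\in\mathbb{Q}(q,z)[[t]],$$ and define $\mathrm{IU}_{\Gamma,n}(q,z)$ for $n\ge1$ as $[n]_q!$ times the coefficient of $t^n$ in the multiplicative inverse of this power series. **Theorem.** Let $\Gamma=\{\alpha^{(1)},\dots,\alpha^{(k)}\}\subseteq S_p$ be a set of $k$ minimal overlapping permutations which all start with $1$, such that $\alpha^{(i)}$ and $\alpha^{(j)}$ are mutually minimal overlapping for all $1\le i<j\le k$. Let $s_i$ be the last letter of $\alpha^{(i)}$.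 Then $$\mathrm{INM}_\Gamma(t,q,z)=\frac{1}{\mathrm{IU}_\Gamma(t,q,z)},\qquad\text{where}\qquad \mathrm{IU}_\Gamma(t,q,z)=1+\sum_{n\ge1}\mathrm{IU}_{\Gamma,n}(q,z)\frac{t^n}{[n]_q!},$$ $\mathrm{IU}_{\Gamma,1}(q,z)=-z$, and for all $n\ge2$ $$\mathrm{IU}_{\Gamma,n}(q,z)=(1-z)\,\mathrm{IU}_{\Gamma,n-1}(q,z)-\sum_{i=1}^k z^{\mathrm{des}(\alpha^{(i)})}q^{\mathrm{inv}(\alpha^{(i)})}\begin{bmatrix}n-s_i\\p-s_i\end{bmatrix}_q\mathrm{IU}_{\Gamma,n-p+1}(q,z),$$ where the sum over $i$ is read as $0$ if $n<p$. -/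

import Mathlib

/-! Permutations in `S_n` are elements of `Equiv.Perm (Fin n)`.  Positions and letters are counted
from `0`, so that the letter `σ_i` of the one-line notation is `σ (i - 1) + 1`. -/

namespace ConsecutivePattern

open Finset

/-- The reduction of a word of distinct letters: the letter at each position is replaced by its
rank among the letters of the word (the smallest letter gets rank `0`). -/
def red {m : ℕ} (w : Fin m → ℕ) (a : Fin m) : ℕ :=
  #{b : Fin m | w b < w a}

/-- There is a `τ`-match in `σ` starting in position `i`: the factor of `σ` of length `p` that
starts in position `i` exists and its reduction is `τ`. -/
def IsMatch {p n : ℕ} (τ : Equiv.Perm (Fin p)) (σ : Equiv.Perm (Fin n)) (i : Fin n) : Prop :=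
  ∃ h : (i : ℕ) + p ≤ n, ∀ a : Fin p,
    red (fun b : Fin p => (σ ⟨(i : ℕ) + b, by omega⟩ : ℕ)) a = (τ a : ℕ)

instance {p n : ℕ} (τ : Equiv.Perm (Fin p)) (σ : Equiv.Perm (Fin n)) (i : Fin n) :
    Decidable (IsMatch τ σ i) := by
  unfold IsMatch
  infer_instance

/-- The number of `τ`-matches of `σ`. -/
def mch {p n : ℕ} (τ : Equiv.Perm (Fin p)) (σ : Equiv.Perm (Fin n)) : ℕ :=
  #{i : Fin n | IsMatch τ σ i}

/-- `τ ∈ S_p`, `p ≥ 3`, is minimal overlapping: the smallest `n` for which some `σ ∈ S_n` has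
exactly two `τ`-matches is `2 p - 1`. -/
def MinimalOverlapping {p : ℕ} (τ : Equiv.Perm (Fin p)) : Prop :=
  3 ≤ p ∧ IsLeast {n : ℕ | ∃ σ : Equiv.Perm (Fin n), mch τ σ = 2} (2 * p - 1)

/-- `α, β ∈ S_p` are mutually minimal overlapping: both are minimal overlapping and the smallest
`n` for which some `σ ∈ S_n` has both an `α`-match and a `β`-match is `2 p - 1`. -/
def MutuallyMinimalOverlapping {p : ℕ} (α β : Equiv.Perm (Fin p)) : Prop :=
  MinimalOverlapping α ∧ MinimalOverlapping β ∧
    IsLeast {n : ℕ | ∃ σ : Equiv.Perm (Fin n), 1 ≤ mch α σ ∧ 1 ≤ mch β σ} (2 * p - 1)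

/-- The one-line notation of `τ` starts with the letter `1` (which is `0` in `Fin p`). -/
def StartsWithOne {p : ℕ} (τ : Equiv.Perm (Fin p)) : Prop :=
  ∃ h : 0 < p, (τ ⟨0, h⟩ : ℕ) = 0

/-- The last letter of the one-line notation of `τ`, an element of `{1, …, p}`
(and `0` for the empty permutation). -/
def lastLetter {p : ℕ} (τ : Equiv.Perm (Fin p)) : ℕ :=
  if h : 0 < p then (τ ⟨p - 1, by omega⟩ : ℕ) + 1 else 0

/-- The number of descents. -/
def des {n : ℕ} (σ : Equiv.Perm (Fin n)) : ℕ :=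
  #{i : Fin n | ∃ h : (i : ℕ) + 1 < n, σ ⟨(i : ℕ) + 1, h⟩ < σ i}

/-- The number of inversions. -/
def inv {n : ℕ} (σ : Equiv.Perm (Fin n)) : ℕ :=
  #{x : Fin n × Fin n | x.1 < x.2 ∧ σ x.2 < σ x.1}

/-- The permutations in `S_n` without `Γ`-matches. -/
def NM {p : ℕ} (Γ : Finset (Equiv.Perm (Fin p))) (n : ℕ) : Finset (Equiv.Perm (Fin n)) :=
  {σ : Equiv.Perm (Fin n) | ∀ i : Fin n, ∀ τ ∈ Γ, ¬ IsMatch τ σ i}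

section Series

variable {K : Type*} [Field K]

/-- `[n]_q = 1 + q + ⋯ + q ^ (n - 1)`. -/
def qNat (q : K) (n : ℕ) : K := ∑ i ∈ range n, q ^ i

/-- `[n]_q! = [1]_q [2]_q ⋯ [n]_q`. -/
def qFactorial (q : K) (n : ℕ) : K := ∏ i ∈ range n, qNat q (i + 1)

/-- The `q`-binomial coefficient `[n]_q! / ([k]_q! [n - k]_q!)`, which is `0` for `k > n`. -/
def qBinom (q : K) (n k : ℕ) : K :=
  if k ≤ n then qFactorial q n / (qFactorial q k * qFactorial q (n - k)) else 0

/-- The formal power series `1 + ∑_{n ≥ 1} f n * t ^ n / [n]_q!` in the variable `t`. -/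
def qSeries (q : K) (f : ℕ → K) : PowerSeries K :=
  PowerSeries.mk fun n => if n = 0 then 1 else f n / qFactorial q n

/-- `INM_{Γ,n}(q, z)`, the sum of `z ^ (des σ + 1) * q ^ inv σ` over all `σ ∈ S_n` without
`Γ`-matches. -/
def INMcoeff {p : ℕ} (Γ : Finset (Equiv.Perm (Fin p))) (q z : K) (n : ℕ) : K :=
  ∑ σ ∈ NM Γ n, z ^ (des σ + 1) * q ^ inv σ

/-- `INM_Γ(t, q, z) = 1 + ∑_{n ≥ 1} INM_{Γ,n}(q, z) * t ^ n / [n]_q!`. -/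
def INM {p : ℕ} (Γ : Finset (Equiv.Perm (Fin p))) (q z : K) : PowerSeries K :=
  qSeries q (INMcoeff Γ q z)

/-- `IU_{Γ,n}(q, z)`: the coefficient of `t ^ n / [n]_q!` in the multiplicative inverse of the
power series `INM_Γ(t, q, z)`, whose constant term is `1`. -/
noncomputable def IUcoeff {p : ℕ} (Γ : Finset (Equiv.Perm (Fin p))) (q z : K) (n : ℕ) : K :=
  qFactorial q n * PowerSeries.coeff n (INM Γ q z)⁻¹

/-- `IU_Γ(t, q, z) = 1 + ∑_{n ≥ 1} IU_{Γ,n}(q, z) * t ^ n / [n]_q!`. -/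
noncomputable def IU {p : ℕ} (Γ : Finset (Equiv.Perm (Fin p))) (q z : K) : PowerSeries K :=
  qSeries q (IUcoeff Γ q z)

end Series

/-- The field `ℚ(q, z)` of rational functions in two indeterminates. -/
abbrev RatQZ : Type := FractionRing (MvPolynomial (Fin 2) ℚ)

/-- The indeterminate `q`. -/
noncomputable def qVar : RatQZ :=
  algebraMap (MvPolynomial (Fin 2) ℚ) RatQZ (MvPolynomial.X 0)

/-- The indeterminate `z`. -/
noncomputable def zVar : RatQZ :=
  algebraMap (MvPolynomial (Fin 2) ℚ) RatQZ (MvPolynomial.X 1)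

end ConsecutivePattern

namespace ConsecutivePattern

open Finset

/-! The reciprocal of `INM` is found by a cancellation that already holds for each single word. Read
a word from the left as a chain of links, each an ascent or a match of an element of `Γ`, the next
link starting at the last letter of the previous one. An ascent contributes `1 - z`, a match of `α`
contributes `-z ^ des α`, and the final single letter `-z`. `clusterWeight` sums the product over
all ways to see the whole word as such a chain.

Cut a nonempty word `l` in all ways into a cluster and a rest weighted by `avoidWeight`. The total
is zero (`splitSum_eq`), by induction on the length: expanding the first link reproduces the way in
which `avoidWeight` depends on the first letter. Minimal overlapping enters here: around a match, no
other match starts before its last letter (`eq_zero_and_eq_of_overlap`). Summing over words with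
weight `q ^ wInv`, where cutting a word gives a `q`-binomial coefficient (`sum_arr_mul`), turns this
into a product of power series equal to `1`. Hence `IUcoeff` is the sum over clusters
(`IUcoeff_eq_wordSum`).

The recursion splits off the first link. As all patterns start with `1`, a cluster of nonzero weight
starts with its smallest letter (`head_lt_of_clusterWeight_ne_zero`). An ascent then just removes
the smallest letter (`sum_arr_ascent`). After a match of `α`, its last letter must be smaller than
everything that follows, so the match uses the `lastLetter α` smallest letters, and the choice of
the others gives the `q`-binomial coefficient (`sum_arr_match`). -/

/-! ### Words of natural numbers -/

/-- The number of inversions of a word. -/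
def wInv : List ℕ → ℕ
  | [] => 0
  | x :: l => l.countP (· < x) + wInv l

/-- The number of descents of a word. -/
def wDes : List ℕ → ℕ
  | [] => 0
  | [_] => 0
  | x :: y :: l => (if y < x then 1 else 0) + wDes (y :: l)

/-- The words that contain each letter of `S` exactly once. -/
def arr (S : Finset ℕ) : Finset (List ℕ) := S.val.lists.toFinset

/-- The number of pairs `(a, b)` in `A × B` with `b < a`. -/
def cross (A B : Finset ℕ) : ℕ := ∑ a ∈ A, #{b ∈ B | b < a}

theorem mem_arr {S : Finset ℕ} {l : List ℕ} : l ∈ arr S ↔ l.Nodup ∧ l.toFinset = S := by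
  unfold arr
  rw [Multiset.mem_toFinset, Multiset.mem_lists_iff]
  constructor
  · intro h
    have hn : l.Nodup := by
      have := S.nodup
      rw [h] at this
      exact this
    refine ⟨hn, ?_⟩
    apply Finset.val_injective
    rw [h, List.toFinset_val, hn.dedup]
    rfl
  · rintro ⟨hn, rfl⟩
    rw [List.toFinset_val, hn.dedup]
    rfl

theorem length_of_mem_arr {S : Finset ℕ} {l : List ℕ} (h : l ∈ arr S) : l.length = #S := by
  obtain ⟨hn, rfl⟩ := mem_arr.1 h
  rw [List.toFinset_card_of_nodup hn]

theorem mem_iff_of_mem_arr {S : Finset ℕ} {l : List ℕ} (h : l ∈ arr S) {x : ℕ} :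
    x ∈ l ↔ x ∈ S := by
  obtain ⟨hn, rfl⟩ := mem_arr.1 h
  simp

theorem arr_empty : arr ∅ = {[]} := by
  ext l
  rw [mem_arr]
  simp only [List.toFinset_eq_empty_iff, mem_singleton]
  exact ⟨fun h => h.2, by rintro rfl; simp⟩

theorem arr_singleton (x : ℕ) : arr {x} = {[x]} := by
  ext l
  constructor
  · intro h
    obtain ⟨y, rfl⟩ := List.length_eq_one_iff.1 (length_of_mem_arr h)
    have := (mem_iff_of_mem_arr h (x := y)).1 (by simp)
    simpa using this
  · intro h
    rw [mem_singleton] at h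
    subst h
    simp [mem_arr]

theorem append_mem_arr {S A : Finset ℕ} (hA : A ⊆ S) {u v : List ℕ} (hu : u ∈ arr A)
    (hv : v ∈ arr (S \ A)) : u ++ v ∈ arr S := by
  obtain ⟨hun, hut⟩ := mem_arr.1 hu
  obtain ⟨hvn, hvt⟩ := mem_arr.1 hv
  refine mem_arr.2 ⟨hun.append hvn ?_, ?_⟩
  · intro x hx hx'
    rw [mem_iff_of_mem_arr hu] at hx
    rw [mem_iff_of_mem_arr hv] at hx'
    exact (mem_sdiff.1 hx').2 hx
  · rw [List.toFinset_append, hut, hvt, union_sdiff_of_subset hA]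

/-- A sum over the words on `S` is split according to the prefix of length `k`. -/
theorem sum_arr_split {M : Type*} [AddCommMonoid M] (S : Finset ℕ) {k : ℕ} (hk : k ≤ #S)
    (H : List ℕ → M) :
    ∑ l ∈ arr S, H l =
      ∑ A ∈ powersetCard k S, ∑ u ∈ arr A, ∑ v ∈ arr (S \ A), H (u ++ v) := by
  simp_rw [sum_sigma']
  refine sum_nbij' (fun l => ⟨(l.take k).toFinset, l.take k, l.drop k⟩)
    (fun x => x.2.1 ++ x.2.2) ?_ ?_ ?_ ?_ ?_
  · intro l hl
    have hlen := length_of_mem_arr hl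
    obtain ⟨hn, ht⟩ := mem_arr.1 hl
    have hnt : (l.take k).Nodup := hn.sublist (List.take_sublist k l)
    have hnd : (l.drop k).Nodup := hn.sublist (List.drop_sublist k l)
    simp only [mem_sigma, mem_powersetCard, mem_arr]
    refine ⟨⟨?_, ?_⟩, ⟨hnt, trivial⟩, hnd, ?_⟩
    · rw [← ht]
      intro x hx
      rw [List.mem_toFinset] at hx ⊢
      exact List.mem_of_mem_take hx
    · rw [List.toFinset_card_of_nodup hnt, List.length_take]
      omega
    · have hd : Disjoint (l.take k).toFinset (l.drop k).toFinset := by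
        rw [List.disjoint_toFinset_iff_disjoint]
        have := hn
        rw [← List.take_append_drop k l] at this
        exact List.disjoint_of_nodup_append this
      have hu : (l.take k).toFinset ∪ (l.drop k).toFinset = S := by
        rw [← List.toFinset_append, List.take_append_drop, ht]
      rw [← hu, union_sdiff_cancel_left hd]
  · rintro ⟨A, u, v⟩ h
    simp only [mem_sigma, mem_powersetCard] at h
    exact append_mem_arr h.1.1 h.2.1 h.2.2
  · intro l _
    simp
  · rintro ⟨A, u, v⟩ h
    simp only [mem_sigma, mem_powersetCard] at h
    have hu : u.length = k := by rw [length_of_mem_arr h.2.1, h.1.2]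
    have := (mem_arr.1 h.2.1).2
    simp [← hu, this]
  · intro l _
    simp

theorem wInv_append (u v : List ℕ) :
    wInv (u ++ v) = (u.map fun x => v.countP (· < x)).sum + wInv u + wInv v := by
  induction u with
  | nil => simp [wInv]
  | cons x u ih =>
    simp only [List.cons_append, wInv, List.countP_append, ih, List.map_cons, List.sum_cons]
    omega

theorem countP_eq_card {l : List ℕ} (hl : l.Nodup) (x : ℕ) :
    l.countP (· < x) = #{b ∈ l.toFinset | b < x} := by
  rw [List.countP_eq_length_filter, ← List.toFinset_card_of_nodup (hl.filter _),
    List.toFinset_filter]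
  simp

theorem wInv_append_arr {A B : Finset ℕ} {u v : List ℕ} (hu : u ∈ arr A) (hv : v ∈ arr B) :
    wInv (u ++ v) = cross A B + wInv u + wInv v := by
  obtain ⟨hun, rfl⟩ := mem_arr.1 hu
  obtain ⟨hvn, rfl⟩ := mem_arr.1 hv
  rw [wInv_append, cross, List.sum_toFinset _ hun]
  simp_rw [countP_eq_card hvn]

theorem wInv_map {φ : ℕ → ℕ} (hφ : StrictMono φ) (l : List ℕ) : wInv (l.map φ) = wInv l := by
  induction l with
  | nil => rfl
  | cons x l ih =>
    simp only [List.map_cons, wInv, ih, List.countP_map]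
    congr 2
    funext y
    simp [hφ.lt_iff_lt]

theorem wDes_map {φ : ℕ → ℕ} (hφ : StrictMono φ) (l : List ℕ) : wDes (l.map φ) = wDes l := by
  induction l with
  | nil => rfl
  | cons x l ih =>
    cases l with
    | nil => rfl
    | cons y l =>
      simp only [List.map_cons, wDes, hφ.lt_iff_lt] at ih ⊢
      rw [ih]

theorem wDes_append_cons (u : List ℕ) (x : ℕ) (v : List ℕ) :
    wDes (u ++ x :: v) = wDes (u ++ [x]) + wDes (x :: v) := by
  induction u with
  | nil => simp [wDes]
  | cons y u ih =>
    cases u with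
    | nil => simp [wDes]
    | cons y' u =>
      simp only [List.cons_append, wDes] at ih ⊢
      omega

/-- The two factors share one letter, so each pair of adjacent positions lies in exactly one of
them. -/
theorem wDes_take_add_drop {l : List ℕ} {k : ℕ} (hk : k < l.length) :
    wDes l = wDes (l.take (k + 1)) + wDes (l.drop k) := by
  have h1 : l = l.take k ++ l[k] :: l.drop (k + 1) := by
    rw [← List.drop_eq_getElem_cons, List.take_append_drop]
  conv_lhs => rw [h1]
  rw [wDes_append_cons, List.take_succ_eq_append_getElem hk, ← List.drop_eq_getElem_cons]

/-! ### Standardization of words -/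

theorem exists_strictMono_image (A : Finset ℕ) :
    ∃ φ : ℕ → ℕ, StrictMono φ ∧ A = (range #A).image φ := by
  induction A using Finset.induction_on_max with
  | empty => exact ⟨id, strictMono_id, by simp⟩
  | insert m A hm ih =>
    obtain ⟨φ, hφ, hA⟩ := ih
    have hmA : m ∉ A := fun h => lt_irrefl _ (hm m h)
    have hlt : ∀ i < #A, φ i < m := fun i hi => hm _ (by
      rw [hA]
      exact mem_image_of_mem _ (mem_range.2 hi))
    -- Index `#A` receives the new maximum `m`; the values beyond it only keep the map strictly
    -- increasing on all of `ℕ`.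
    refine ⟨fun i => if i < #A then φ i else m + (i - #A), ?_, ?_⟩
    · intro i j hij
      dsimp only
      split_ifs with h1 h2 h2
      · exact hφ hij
      · have := hlt i h1
        omega
      · omega
      · omega
    · rw [card_insert_of_notMem hmA, range_add_one, image_insert]
      simp only [lt_self_iff_false, if_false, Nat.sub_self, add_zero]
      congr 1
      conv_lhs => rw [hA]
      refine image_congr ?_
      intro i hi
      have : i < #A := by simpa using hi
      simp [this]

theorem toFinset_map_word (φ : ℕ → ℕ) (l : List ℕ) :
    (l.map φ).toFinset = l.toFinset.image φ := by
  ext x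
  simp

theorem arr_image {φ : ℕ → ℕ} (hφ : StrictMono φ) (S : Finset ℕ) :
    arr (S.image φ) = (arr S).image (List.map φ) := by
  ext l
  rw [mem_image]
  constructor
  · intro h
    have hl : ∀ x ∈ l, x ∈ Set.range φ := by
      intro x hx
      rw [mem_iff_of_mem_arr h, mem_image] at hx
      obtain ⟨y, _, rfl⟩ := hx
      exact ⟨y, rfl⟩
    obtain ⟨l', rfl⟩ : ∃ l', List.map φ l' = l := by
      have : l ∈ Set.range (List.map φ) := by
        rw [Set.range_list_map]
        exact hl
      exact this
    refine ⟨l', ?_, rfl⟩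
    obtain ⟨h1, h2⟩ := mem_arr.1 h
    refine mem_arr.2 ⟨h1.of_map, ?_⟩
    rw [toFinset_map_word] at h2
    exact image_injective hφ.injective h2
  · rintro ⟨l', h, rfl⟩
    obtain ⟨h1, rfl⟩ := mem_arr.1 h
    exact mem_arr.2 ⟨h1.map hφ.injective, by rw [toFinset_map_word]⟩

theorem exists_standardization {l : List ℕ} (hl : l.Nodup) :
    ∃ φ : ℕ → ℕ, StrictMono φ ∧ ∃ l' ∈ arr (range l.length), l = l'.map φ := by
  obtain ⟨φ, hφ, h⟩ := exists_strictMono_image l.toFinset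
  refine ⟨φ, hφ, ?_⟩
  rw [List.toFinset_card_of_nodup hl] at h
  have : l ∈ arr ((range l.length).image φ) := mem_arr.2 ⟨hl, h⟩
  rw [arr_image hφ, mem_image] at this
  obtain ⟨l', h1, h2⟩ := this
  exact ⟨l', h1, h2.symm⟩

theorem sum_arr_image {M : Type*} [AddCommMonoid M] {φ : ℕ → ℕ} (hφ : StrictMono φ)
    (S : Finset ℕ) (H : List ℕ → M) :
    ∑ l ∈ arr (S.image φ), H l = ∑ l ∈ arr S, H (l.map φ) := by
  rw [arr_image hφ, sum_image]
  exact fun _ _ _ _ h => List.map_injective_iff.2 hφ.injective h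

/-- The value of a sum over the words on `S` depends only on the number of letters, if the summands
depend only on the relative order of the letters. -/
theorem sum_arr_eq_of_card {M : Type*} [AddCommMonoid M] {H : List ℕ → M}
    (hH : ∀ φ : ℕ → ℕ, StrictMono φ → ∀ l, H (l.map φ) = H l) (S : Finset ℕ) :
    ∑ l ∈ arr S, H l = ∑ l ∈ arr (range #S), H l := by
  obtain ⟨φ, hφ, h⟩ := exists_strictMono_image S
  conv_lhs => rw [h]
  rw [sum_arr_image hφ]
  exact sum_congr rfl fun l _ => hH φ hφ l

/-! ### One-line notation -/

/-- The one-line notation of a permutation. -/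
def oneLine {n : ℕ} (σ : Equiv.Perm (Fin n)) : List ℕ := List.ofFn fun i => (σ i : ℕ)

theorem length_oneLine {n : ℕ} (σ : Equiv.Perm (Fin n)) : (oneLine σ).length = n := by
  simp [oneLine]

theorem oneLine_mem_arr {n : ℕ} (σ : Equiv.Perm (Fin n)) : oneLine σ ∈ arr (range n) := by
  refine mem_arr.2 ⟨?_, ?_⟩
  · rw [oneLine, List.nodup_ofFn]
    exact Fin.val_injective.comp σ.injective
  · ext x
    simp only [oneLine, List.mem_toFinset, List.mem_ofFn, mem_range]
    constructor
    · rintro ⟨i, rfl⟩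
      exact (σ i).2
    · intro hx
      exact ⟨σ.symm ⟨x, hx⟩, by simp⟩

theorem oneLine_injective {n : ℕ} : Function.Injective (oneLine (n := n)) := by
  intro σ τ h
  have := List.ofFn_injective h
  ext i
  exact congrFun this i

theorem exists_oneLine {n : ℕ} {l : List ℕ} (hl : l ∈ arr (range n)) :
    ∃ σ : Equiv.Perm (Fin n), oneLine σ = l := by
  have hlen : l.length = n := by simpa using length_of_mem_arr hl
  subst hlen
  have hlt : ∀ i : Fin l.length, l[i] < l.length := fun i =>
    mem_range.1 ((mem_iff_of_mem_arr hl).1 (List.getElem_mem _))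
  let f : Fin l.length → Fin l.length := fun i => ⟨l[i], hlt i⟩
  have hf : Function.Injective f := by
    intro i j h
    have h' : l[i] = l[j] := congrArg Fin.val h
    exact Fin.ext ((mem_arr.1 hl).1.getElem_inj_iff.1 h')
  refine ⟨Equiv.ofBijective f (Finite.injective_iff_bijective.1 hf), ?_⟩
  simp [oneLine, f]

theorem sum_perm_eq_sum_arr {M : Type*} [AddCommMonoid M] (n : ℕ) (H : List ℕ → M) :
    ∑ σ : Equiv.Perm (Fin n), H (oneLine σ) = ∑ l ∈ arr (range n), H l := by
  refine sum_bij (fun σ _ => oneLine σ) ?_ ?_ ?_ ?_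
  · exact fun σ _ => oneLine_mem_arr σ
  · exact fun σ _ τ _ h => oneLine_injective h
  · intro l hl
    obtain ⟨σ, h⟩ := exists_oneLine hl
    exact ⟨σ, mem_univ _, h⟩
  · exact fun _ _ => rfl

theorem countP_ofFn {n : ℕ} (f : Fin n → ℕ) (x : ℕ) :
    (List.ofFn f).countP (· < x) = ∑ i, if f i < x then 1 else 0 := by
  induction n with
  | zero => simp
  | succ n ih =>
    rw [List.ofFn_succ, List.countP_cons, ih, Fin.sum_univ_succ]
    simp [add_comm]

theorem wInv_ofFn {n : ℕ} (f : Fin n → ℕ) :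
    wInv (List.ofFn f) = ∑ i, ∑ j, if i < j ∧ f j < f i then 1 else 0 := by
  induction n with
  | zero => simp [wInv]
  | succ n ih =>
    rw [List.ofFn_succ, wInv, ih, countP_ofFn, Fin.sum_univ_succ]
    simp_rw [Fin.sum_univ_succ]
    simp

theorem inv_eq_wInv {n : ℕ} (σ : Equiv.Perm (Fin n)) : inv σ = wInv (oneLine σ) := by
  rw [inv, oneLine, wInv_ofFn, card_filter, Fintype.sum_prod_type]
  simp

theorem wDes_ofFn {n : ℕ} (f : Fin n → ℕ) :
    wDes (List.ofFn f) =
      ∑ i : Fin n, if ∃ h : (i : ℕ) + 1 < n, f ⟨(i : ℕ) + 1, h⟩ < f i then 1 else 0 := by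
  induction n with
  | zero => simp [wDes]
  | succ n ih =>
    cases n with
    | zero =>
      have h0 : wDes (List.ofFn f) = 0 := by simp [wDes]
      rw [h0]
      symm
      refine sum_eq_zero fun i _ => if_neg ?_
      rintro ⟨h, _⟩
      omega
    | succ n =>
      have := ih (fun i => f i.succ)
      rw [List.ofFn_succ] at this
      rw [List.ofFn_succ, List.ofFn_succ, wDes, this, Fin.sum_univ_succ (n := n + 1)]
      refine congrArg₂ (HAdd.hAdd : ℕ → ℕ → ℕ) ?_ ?_
      · have h1 : (∃ h : ((0 : Fin (n + 2)) : ℕ) + 1 < n + 2,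
            f ⟨((0 : Fin (n + 2)) : ℕ) + 1, h⟩ < f 0) ↔ f (Fin.succ 0) < f 0 :=
          ⟨fun ⟨_, h⟩ => h, fun h => ⟨by simp, h⟩⟩
        exact if_congr h1.symm rfl rfl
      · refine sum_congr rfl fun i _ => ?_
        have h1 : (∃ h : (i : ℕ) + 1 < n + 1, f (Fin.succ ⟨(i : ℕ) + 1, h⟩) < f i.succ) ↔
            ∃ h : (i.succ : ℕ) + 1 < n + 2, f ⟨(i.succ : ℕ) + 1, h⟩ < f i.succ :=
          ⟨fun ⟨h, h'⟩ => ⟨by simpa using h, h'⟩, fun ⟨h, h'⟩ => ⟨by simpa using h, h'⟩⟩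
        exact if_congr h1 rfl rfl

theorem des_eq_wDes {n : ℕ} (σ : Equiv.Perm (Fin n)) : des σ = wDes (oneLine σ) := by
  rw [des, oneLine, wDes_ofFn, card_filter]
  simp

/-! ### Matches in words -/

/-- The word `l` starts with a `τ`-match. -/
def Pre {p : ℕ} (τ : Equiv.Perm (Fin p)) (l : List ℕ) : Prop :=
  p ≤ l.length ∧ ∀ a b : Fin p, l.getD a 0 < l.getD b 0 ↔ τ a < τ b

instance {p : ℕ} (τ : Equiv.Perm (Fin p)) (l : List ℕ) : Decidable (Pre τ l) := by
  unfold Pre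
  infer_instance

/-- The rank of a letter counts the letters below it, and these lower sets are nested in the order
of the letters. This replaces ranks by order comparisons, which strictly increasing maps preserve.
-/
theorem red_eq_iff {p : ℕ} (τ : Equiv.Perm (Fin p)) (w : Fin p → ℕ) :
    (∀ a, red w a = (τ a : ℕ)) ↔ ∀ a b, w a < w b ↔ τ a < τ b := by
  constructor
  · intro h a b
    rw [Fin.lt_def, ← h a, ← h b]
    constructor
    · intro hab
      refine card_lt_card ⟨?_, ?_⟩
      · intro c hc
        simp only [mem_filter, mem_univ, true_and] at hc ⊢
        exact hc.trans hab
      · intro hsub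
        have := hsub (x := a) (by simpa using hab)
        simp at this
    · intro hab
      by_contra hle
      refine absurd hab (not_lt.2 (card_le_card ?_))
      intro c hc
      simp only [mem_filter, mem_univ, true_and] at hc ⊢
      omega
  · intro h a
    rw [red]
    simp_rw [h]
    have : #{b : Fin p | τ b < τ a} = #(Iio (τ a)) := by
      refine card_bij (fun b _ => τ b) ?_ ?_ ?_
      · simp
      · simp
      · intro b hb
        exact ⟨τ.symm b, by simpa using hb, by simp⟩
    rw [this, Fin.card_Iio]

theorem isMatch_iff {p n : ℕ} (τ : Equiv.Perm (Fin p)) (σ : Equiv.Perm (Fin n)) (i : Fin n) :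
    IsMatch τ σ i ↔ Pre τ ((oneLine σ).drop i) := by
  unfold IsMatch Pre
  simp_rw [red_eq_iff]
  have hlen : p ≤ ((oneLine σ).drop i).length ↔ (i : ℕ) + p ≤ n := by
    rw [List.length_drop, length_oneLine]
    have := i.2
    omega
  rw [hlen]
  constructor
  · rintro ⟨h, h'⟩
    refine ⟨h, fun a b => ?_⟩
    rw [← h' a b]
    have ha : (i : ℕ) + a < n := by omega
    have hb : (i : ℕ) + b < n := by omega
    simp [oneLine, List.getD_eq_getElem?_getD, ha, hb]
  · rintro ⟨h, h'⟩
    refine ⟨h, fun a b => ?_⟩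
    rw [← h' a b]
    have ha : (i : ℕ) + a < n := by omega
    have hb : (i : ℕ) + b < n := by omega
    simp [oneLine, List.getD_eq_getElem?_getD, ha, hb]

theorem pre_map {p : ℕ} (τ : Equiv.Perm (Fin p)) {φ : ℕ → ℕ} (hφ : StrictMono φ) (l : List ℕ) :
    Pre τ (l.map φ) ↔ Pre τ l := by
  unfold Pre
  rw [List.length_map]
  refine and_congr_right fun h => forall_congr' fun a => forall_congr' fun b => ?_
  have ha : (a : ℕ) < l.length := by omega
  have hb : (b : ℕ) < l.length := by omega
  simp [List.getD_eq_getElem?_getD, ha, hb, hφ.lt_iff_lt]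

theorem pre_take {p : ℕ} (τ : Equiv.Perm (Fin p)) (l : List ℕ) (k : ℕ) :
    Pre τ (l.take k) ↔ p ≤ k ∧ Pre τ l := by
  unfold Pre
  rw [List.length_take, le_min_iff, and_assoc]
  refine and_congr_right fun hk => and_congr_right fun h => ?_
  refine forall_congr' fun a => forall_congr' fun b => ?_
  have ha : (a : ℕ) < k := by omega
  have hb : (b : ℕ) < k := by omega
  simp [List.getD_eq_getElem?_getD, ha, hb]

theorem pre_oneLine_self {p : ℕ} (τ : Equiv.Perm (Fin p)) : Pre τ (oneLine τ) := by
  refine ⟨(length_oneLine τ).ge, fun a b => ?_⟩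
  simp [oneLine, List.getD_eq_getElem?_getD]

theorem pre_oneLine_iff {p : ℕ} (τ σ : Equiv.Perm (Fin p)) : Pre τ (oneLine σ) ↔ σ = τ := by
  constructor
  · rintro ⟨_, h⟩
    have h1 : ∀ a b, σ a < σ b ↔ τ a < τ b := by
      intro a b
      rw [← h a b]
      simp [oneLine, List.getD_eq_getElem?_getD]
    have h2 := (red_eq_iff τ fun a => (σ a : ℕ)).2 (fun a b => by simpa using h1 a b)
    have h3 := (red_eq_iff σ fun a => (σ a : ℕ)).2 (fun a b => by simp)
    ext a
    rw [← h2 a, ← h3 a]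
  · rintro rfl
    exact pre_oneLine_self σ

theorem Pre.exists_map {p : ℕ} {τ : Equiv.Perm (Fin p)} {l : List ℕ} (h : Pre τ l)
    (hl : l.Nodup) : ∃ φ : ℕ → ℕ, StrictMono φ ∧ l.take p = (oneLine τ).map φ := by
  have hn : (l.take p).Nodup := hl.sublist (List.take_sublist p l)
  have hlen : (l.take p).length = p := by
    rw [List.length_take]
    exact min_eq_left h.1
  obtain ⟨φ, hφ, l', hl', heq⟩ := exists_standardization hn
  rw [hlen] at hl'
  obtain ⟨σ, rfl⟩ := exists_oneLine hl'
  have h1 : Pre τ (l.take p) := (pre_take τ l p).2 ⟨le_rfl, h⟩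
  rw [heq, pre_map τ hφ, pre_oneLine_iff] at h1
  exact ⟨φ, hφ, by rw [heq, h1]⟩

/-! ### Overlapping matches -/

/-- The overlap hypotheses speak of permutations; standardizing a prefix of a word makes them
applicable to matches in words. -/
theorem exists_perm_of_take {l : List ℕ} (hl : l.Nodup) {n : ℕ} (hn : n ≤ l.length) :
    ∃ σ : Equiv.Perm (Fin n), ∀ {p : ℕ} (τ : Equiv.Perm (Fin p)) (i : Fin n),
      IsMatch τ σ i ↔ (i : ℕ) + p ≤ n ∧ Pre τ (l.drop i) := by
  have hnd : (l.take n).Nodup := hl.sublist (List.take_sublist n l)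
  have hlen : (l.take n).length = n := by
    rw [List.length_take]
    exact min_eq_left hn
  obtain ⟨φ, hφ, l', hl', heq⟩ := exists_standardization hnd
  rw [hlen] at hl'
  obtain ⟨σ, rfl⟩ := exists_oneLine hl'
  refine ⟨σ, fun {p} τ i => ?_⟩
  rw [isMatch_iff, ← pre_map τ hφ, List.map_drop, ← heq, List.drop_take, pre_take]
  refine and_congr_left fun _ => ?_
  have := i.2
  omega

/-- Two matches in a word whose positions differ by less than `p - 1` coincide. -/
theorem eq_zero_and_eq_of_overlap {p : ℕ} {Γ : Finset (Equiv.Perm (Fin p))}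
    (hmin : ∀ α ∈ Γ, MinimalOverlapping α)
    (hmut : ∀ α ∈ Γ, ∀ β ∈ Γ, α ≠ β → MutuallyMinimalOverlapping α β)
    {α β : Equiv.Perm (Fin p)} (hα : α ∈ Γ) (hβ : β ∈ Γ) {l : List ℕ} (hl : l.Nodup)
    (h0 : Pre α l) {i : ℕ} (hi : i + 1 < p) (h1 : Pre β (l.drop i)) : i = 0 ∧ α = β := by
  have key : ∀ {j : ℕ} {τ : Equiv.Perm (Fin p)}, Pre τ (l.drop j) → j + p ≤ l.length := by
    intro j τ h
    have := h.1
    rw [List.length_drop] at this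
    omega
  by_cases hab : α = β
  · subst hab
    refine ⟨?_, rfl⟩
    by_contra hi0
    -- `MinimalOverlapping` needs exactly two matches. With `j` the first positive match position,
    -- the prefix of length `j + p < 2 * p - 1` has only the matches at `0` and `j`.
    have hex : ∃ j, j ≠ 0 ∧ Pre α (l.drop j) := ⟨i, hi0, h1⟩
    obtain ⟨hj0, hj⟩ := Nat.find_spec hex
    have hji : Nat.find hex ≤ i := Nat.find_min' hex ⟨hi0, h1⟩
    have hmin' : ∀ m, m ≠ 0 → Pre α (l.drop m) → Nat.find hex ≤ m :=
      fun m h h' => Nat.find_min' hex ⟨h, h'⟩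
    generalize Nat.find hex = j at hj0 hj hji hmin'
    obtain ⟨σ, hσ⟩ := exists_perm_of_take hl (key hj)
    have hmem : j + p ∈ {n : ℕ | ∃ σ : Equiv.Perm (Fin n), mch α σ = 2} := by
      refine ⟨σ, ?_⟩
      have : ({i | IsMatch α σ i} : Finset (Fin (j + p))) =
          {⟨0, by omega⟩, ⟨j, by omega⟩} := by
        ext x
        simp only [mem_filter, mem_univ, true_and, mem_insert, mem_singleton, hσ, Fin.ext_iff]
        constructor
        · rintro ⟨hx, hx'⟩
          by_cases h : (x : ℕ) = 0
          · exact Or.inl h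
          · have := hmin' x h hx'
            omega
        · rintro (h | h)
          · rw [h]
            exact ⟨by omega, by simpa using h0⟩
          · rw [h]
            exact ⟨le_rfl, hj⟩
      rw [mch, this, card_pair]
      intro h
      exact hj0 (Fin.mk.inj h).symm
    have := (hmin α hα).2.2 hmem
    omega
  · exfalso
    obtain ⟨σ, hσ⟩ := exists_perm_of_take hl (key h1)
    have hmem : i + p ∈ {n : ℕ | ∃ σ : Equiv.Perm (Fin n), 1 ≤ mch α σ ∧ 1 ≤ mch β σ} := by
      refine ⟨σ, card_pos.2 ⟨⟨0, by omega⟩, ?_⟩, card_pos.2 ⟨⟨i, by omega⟩, ?_⟩⟩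
      · simp only [mem_filter, mem_univ, true_and, hσ]
        exact ⟨by omega, by simpa using h0⟩
      · simp only [mem_filter, mem_univ, true_and, hσ]
        exact ⟨le_rfl, h1⟩
    have := (hmut α hα β hβ hab).2.2.2 hmem
    omega

/-! ### Weights of words -/

/-- The word `l` has no `Γ`-matches. -/
def Avoids {p : ℕ} (Γ : Finset (Equiv.Perm (Fin p))) (l : List ℕ) : Prop :=
  ∀ i, ∀ τ ∈ Γ, ¬ Pre τ (l.drop i)

theorem avoids_cons {p : ℕ} {Γ : Finset (Equiv.Perm (Fin p))} {x : ℕ} {l : List ℕ} :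
    Avoids Γ (x :: l) ↔ (∀ τ ∈ Γ, ¬ Pre τ (x :: l)) ∧ Avoids Γ l := by
  constructor
  · exact fun h => ⟨h 0, fun i => h (i + 1)⟩
  · rintro ⟨h0, h⟩ (_ | i)
    · exact h0
    · exact h i

variable {K : Type*} [Field K]

open Classical in
/-- The weight of a nonempty word without `Γ`-matches is `z ^ (des + 1)`. -/
noncomputable def avoidWeight {p : ℕ} (Γ : Finset (Equiv.Perm (Fin p))) (z : K) (l : List ℕ) : K :=
  if l = [] then 1 else if Avoids Γ l then z ^ (wDes l + 1) else 0

/-- The signed weight of a word as a cluster, that is, as a chain of ascents and of matches of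
elements of `Γ`, two consecutive links of which share exactly one letter. -/
noncomputable def clusterWeight {p : ℕ} (Γ : Finset (Equiv.Perm (Fin p))) (z : K) : List ℕ → K
  | [] => 1
  | [_] => -z
  | x :: y :: l =>
    (if x < y then (1 - z) * clusterWeight Γ z (y :: l) else 0) -
      ∑ α ∈ Γ, if Pre α (x :: y :: l) then
        z ^ des α * clusterWeight Γ z ((y :: l).drop (p - 2)) else 0
termination_by l => l.length
decreasing_by
  all_goals simp

theorem clusterWeight_map {p : ℕ} (Γ : Finset (Equiv.Perm (Fin p))) (z : K) {φ : ℕ → ℕ}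
    (hφ : StrictMono φ) (l : List ℕ) :
    clusterWeight Γ z (l.map φ) = clusterWeight Γ z l := by
  induction hn : l.length using Nat.strong_induction_on generalizing l with
  | _ n ih =>
    match l with
    | [] => rw [List.map_nil]
    | [x] => simp [clusterWeight]
    | x :: y :: l =>
      have h1 := ih _ (by simp [← hn]) (y :: l) rfl
      have h2 := ih _ (by simp [← hn]) ((y :: l).drop (p - 2)) rfl
      have h3 : ∀ α : Equiv.Perm (Fin p), Pre α (φ x :: φ y :: l.map φ) ↔ Pre α (x :: y :: l) :=
        fun α => pre_map α hφ (x :: y :: l)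
      rw [List.map_drop] at h2
      simp only [List.map_cons] at h1 h2 ⊢
      rw [clusterWeight, clusterWeight, h1, h2]
      simp only [h3, hφ.lt_iff_lt]

/-- A word with a nonzero cluster weight starts with its smallest letter. -/
theorem head_lt_of_clusterWeight_ne_zero {p : ℕ} {Γ : Finset (Equiv.Perm (Fin p))}
    (hp : ∀ α ∈ Γ, 3 ≤ p) (hone : ∀ α ∈ Γ, StartsWithOne α) (z : K) {x : ℕ} {l : List ℕ}
    (h : clusterWeight Γ z (x :: l) ≠ 0) : ∀ y ∈ l, x < y := by
  induction hn : l.length using Nat.strong_induction_on generalizing l x with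
  | _ n ih =>
    match l with
    | [] => simp
    | y :: l =>
      -- Some first link has a nonzero contribution: either the ascent, or else a match.
      by_cases hxy : x < y ∧ clusterWeight Γ z (y :: l) ≠ 0
      · have := ih _ (by simp [← hn]) hxy.2 rfl
        intro w hw
        rcases List.mem_cons.1 hw with rfl | hw
        · exact hxy.1
        · exact hxy.1.trans (this w hw)
      · have h1 : (if x < y then (1 - z) * clusterWeight Γ z (y :: l) else 0) = 0 := by
          split_ifs with h'
          · have : clusterWeight Γ z (y :: l) = 0 := by
              by_contra h''
              exact hxy ⟨h', h''⟩
            rw [this, mul_zero]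
          · rfl
        rw [clusterWeight, h1, zero_sub, neg_ne_zero] at h
        obtain ⟨α, hα, h⟩ := exists_ne_zero_of_sum_ne_zero h
        obtain ⟨hpre, h⟩ : Pre α (x :: y :: l) ∧
            clusterWeight Γ z ((y :: l).drop (p - 2)) ≠ 0 := by
          split_ifs at h with h'
          · exact ⟨h', right_ne_zero_of_mul h⟩
          · exact absurd rfl h
        have hp3 := hp α hα
        obtain ⟨h0, hα0⟩ := hone α hα
        have hlen := hpre.1
        simp only [List.length_cons] at hlen hn
        have hfirst : ∀ j, j + 1 < p → x < (y :: l).getD j 0 := by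
          intro j hj
          have := (hpre.2 ⟨0, h0⟩ ⟨j + 1, hj⟩).2 (by
            rw [Fin.lt_def, hα0]
            refine Nat.pos_of_ne_zero fun h => ?_
            have := α.injective (Fin.ext (hα0.trans h.symm))
            simp at this)
          simpa using this
        have hlt : p - 2 < (y :: l).length := by
          simp only [List.length_cons]
          omega
        rw [List.drop_eq_getElem_cons hlt] at h
        have hrest := ih _ (by simp; omega) h rfl
        have hmid : x < (y :: l)[p - 2] := by
          have := hfirst (p - 2) (by omega)
          rwa [List.getD_eq_getElem _ _ hlt] at this
        -- Letters inside the match exceed `x` because the pattern starts with `1`; later letters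
        -- exceed the last letter of the match, which heads the remaining cluster.
        intro w hw
        obtain ⟨j, hj, rfl⟩ := List.getElem_of_mem hw
        by_cases hjp : j + 1 < p
        · have := hfirst j hjp
          rwa [List.getD_eq_getElem _ _ hj] at this
        · refine hmid.trans (hrest _ ?_)
          rw [List.mem_iff_getElem]
          refine ⟨j - (p - 2 + 1), by simp at hj ⊢; omega, ?_⟩
          rw [List.getElem_drop]
          congr 1
          omega

theorem avoidWeight_cons {p : ℕ} {Γ : Finset (Equiv.Perm (Fin p))}
    (z : K) {x y : ℕ} {l : List ℕ} (h : ∀ τ ∈ Γ, ¬ Pre τ (x :: y :: l)) :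
    avoidWeight Γ z (x :: y :: l) = (if y < x then z else 1) * avoidWeight Γ z (y :: l) := by
  have : Avoids Γ (x :: y :: l) ↔ Avoids Γ (y :: l) := by
    rw [avoids_cons]
    exact and_iff_right h
  unfold avoidWeight
  by_cases h1 : Avoids Γ (y :: l)
  · rw [if_neg (List.cons_ne_nil _ _), if_neg (List.cons_ne_nil _ _), if_pos h1, if_pos (this.2 h1), wDes]
    split_ifs <;> ring
  · rw [if_neg (List.cons_ne_nil _ _), if_neg (List.cons_ne_nil _ _), if_neg h1, if_neg (fun h => h1 (this.1 h)), mul_zero]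

/-- No match starts at the positions `1, …, p - 2`, so deleting all letters of the initial match but
its last one does not affect whether the rest after `x` avoids `Γ`. The descents lost are those of
`α`. -/
theorem avoidWeight_of_pre {p : ℕ} {Γ : Finset (Equiv.Perm (Fin p))}
    (hmin : ∀ α ∈ Γ, MinimalOverlapping α)
    (hmut : ∀ α ∈ Γ, ∀ β ∈ Γ, α ≠ β → MutuallyMinimalOverlapping α β)
    (z : K) {α : Equiv.Perm (Fin p)} (hα : α ∈ Γ) {x y : ℕ} {l : List ℕ}
    (hl : (x :: y :: l).Nodup) (h : Pre α (x :: y :: l)) :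
    (if y < x then z else 1) * avoidWeight Γ z (y :: l) =
      z ^ des α * avoidWeight Γ z ((y :: l).drop (p - 2)) := by
  have hp := (hmin α hα).1
  have hlen := h.1
  simp only [List.length_cons] at hlen
  have hav : Avoids Γ (y :: l) ↔ Avoids Γ ((y :: l).drop (p - 2)) := by
    constructor
    · intro h' i
      rw [List.drop_drop]
      exact h' _
    · intro h' i τ hτ hpre
      by_cases hi : i + 2 < p
      · have := eq_zero_and_eq_of_overlap hmin hmut hα hτ hl h (i := i + 1) hi hpre
        omega
      · refine h' (i - (p - 2)) τ hτ ?_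
        rw [List.drop_drop]
        rwa [show p - 2 + (i - (p - 2)) = i by omega]
  have hne : (y :: l).drop (p - 2) ≠ [] := by
    rw [Ne, List.drop_eq_nil_iff, List.length_cons]
    omega
  have hdes : (if y < x then 1 else 0) + wDes (y :: l) =
      des α + wDes ((y :: l).drop (p - 2)) := by
    have h1 := wDes_take_add_drop (l := x :: y :: l) (k := p - 1) (by
      simp only [List.length_cons]
      omega)
    obtain ⟨φ, hφ, htake⟩ := h.exists_map hl
    rw [show p - 1 + 1 = p by omega, htake, wDes_map hφ, ← des_eq_wDes,
      show p - 1 = p - 2 + 1 by omega, List.drop_succ_cons] at h1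
    exact h1
  have hz : (if y < x then z else 1) * z ^ (wDes (y :: l) + 1) =
      z ^ des α * z ^ (wDes ((y :: l).drop (p - 2)) + 1) := by
    rw [← pow_add, ← add_assoc, ← hdes]
    split_ifs <;> ring
  unfold avoidWeight
  rw [if_neg (by simp : y :: l ≠ []), if_neg hne]
  by_cases h1 : Avoids Γ (y :: l)
  · rw [if_pos h1, if_pos (hav.1 h1), hz]
  · rw [if_neg h1, if_neg (fun h => h1 (hav.2 h)), mul_zero, mul_zero]

/-- The sum over the factorizations of `l` in a nonempty cluster and a word without matches. -/
noncomputable def splitSum {p : ℕ} (Γ : Finset (Equiv.Perm (Fin p))) (z : K) (l : List ℕ) : K :=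
  ∑ k ∈ range l.length, clusterWeight Γ z (l.take (k + 1)) * avoidWeight Γ z (l.drop (k + 1))

/-- The cluster is either the single letter `x` or has a first link. Removing that link leaves a cut
of the word that starts at the link's last letter. -/
theorem splitSum_cons_cons {p : ℕ} {Γ : Finset (Equiv.Perm (Fin p))} (hp : ∀ α ∈ Γ, 3 ≤ p)
    (z : K) (x y : ℕ) (l : List ℕ) :
    splitSum Γ z (x :: y :: l) = -z * avoidWeight Γ z (y :: l) +
      (if x < y then (1 - z) * splitSum Γ z (y :: l) else 0) -
      ∑ α ∈ Γ, if Pre α (x :: y :: l) then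
        z ^ des α * splitSum Γ z ((y :: l).drop (p - 2)) else 0 := by
  have hstep : ∀ k ∈ range (l.length + 1),
      clusterWeight Γ z ((x :: y :: l).take (k + 1 + 1)) *
        avoidWeight Γ z ((x :: y :: l).drop (k + 1 + 1)) =
      (if x < y then (1 - z) * (clusterWeight Γ z ((y :: l).take (k + 1)) *
        avoidWeight Γ z ((y :: l).drop (k + 1))) else 0) -
      ∑ α ∈ Γ, if Pre α (x :: y :: l) then (if p ≤ k + 2 then
        z ^ des α * (clusterWeight Γ z (((y :: l).drop (p - 2)).take (k + 1 - (p - 2))) *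
          avoidWeight Γ z ((y :: l).drop (k + 1))) else 0) else 0 := by
    intro k _
    have hpre : ∀ α : Equiv.Perm (Fin p), Pre α (x :: y :: l.take k) ↔
        p ≤ k + 2 ∧ Pre α (x :: y :: l) := fun α => pre_take α (x :: y :: l) (k + 2)
    have hdt : (y :: l.take k).drop (p - 2) =
        ((y :: l).drop (p - 2)).take (k + 1 - (p - 2)) := by
      rw [← List.drop_take, List.take_succ_cons]
    simp only [List.take_succ_cons, List.drop_succ_cons]
    rw [clusterWeight, sub_mul, sum_mul, hdt]
    congr 1
    · split_ifs <;> ring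
    · refine sum_congr rfl fun α _ => ?_
      simp only [hpre]
      by_cases hk : p ≤ k + 2 <;> by_cases hq : Pre α (x :: y :: l) <;> simp [hk, hq, mul_assoc]
  rw [splitSum, List.length_cons, List.length_cons, sum_range_succ', sum_congr rfl hstep,
    sum_sub_distrib, sum_comm (s := range (l.length + 1))]
  have h1 : ∑ k ∈ range (l.length + 1), (if x < y then (1 - z) *
      (clusterWeight Γ z ((y :: l).take (k + 1)) * avoidWeight Γ z ((y :: l).drop (k + 1)))
      else 0) = if x < y then (1 - z) * splitSum Γ z (y :: l) else 0 := by
    split_ifs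
    · rw [← mul_sum, splitSum, List.length_cons]
    · simp
  have h2 : ∀ α ∈ Γ, ∑ k ∈ range (l.length + 1), (if Pre α (x :: y :: l) then (if p ≤ k + 2 then
        z ^ des α * (clusterWeight Γ z (((y :: l).drop (p - 2)).take (k + 1 - (p - 2))) *
          avoidWeight Γ z ((y :: l).drop (k + 1))) else 0) else 0) =
      if Pre α (x :: y :: l) then
        z ^ des α * splitSum Γ z ((y :: l).drop (p - 2)) else 0 := by
    intro α hα
    have hp3 := hp α hα
    split_ifs with hpre
    · have hlen := hpre.1
      simp only [List.length_cons] at hlen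
      rw [← sum_filter, splitSum, mul_sum]
      symm
      -- A cut after `j + 1` letters of the shortened word is a cut after `j + 1 + (p - 2)` letters
      -- of `y :: l`; shorter clusters cannot contain the match.
      refine sum_nbij' (fun j => j + (p - 2)) (fun k => k - (p - 2)) ?_ ?_ ?_ ?_ ?_
      · intro j hj
        simp at hj ⊢
        omega
      · intro k hk
        simp at hk ⊢
        omega
      · intro j _
        simp
      · intro k hk
        simp at hk ⊢
        omega
      · intro j _
        rw [List.drop_drop, show j + (p - 2) + 1 - (p - 2) = j + 1 by omega,
          show p - 2 + (j + 1) = j + (p - 2) + 1 by omega]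
    · simp
  rw [h1, sum_congr rfl h2]
  simp [clusterWeight]
  ring

/-- By induction, the single letter and the ascent link together give minus the weight that the word
would have if no match started at `x`: the factor is `-z - (1 - z) = -1` at an ascent and `-z` at a
descent. If a match does start at `x`, it is unique, and its term cancels this by
`avoidWeight_of_pre`, as the weight is then `0`. -/
theorem splitSum_eq {p : ℕ} {Γ : Finset (Equiv.Perm (Fin p))}
    (hmin : ∀ α ∈ Γ, MinimalOverlapping α)
    (hmut : ∀ α ∈ Γ, ∀ β ∈ Γ, α ≠ β → MutuallyMinimalOverlapping α β)
    (z : K) {l : List ℕ} (hl : l.Nodup) (hne : l ≠ []) :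
    splitSum Γ z l = -avoidWeight Γ z l := by
  have hp : ∀ α ∈ Γ, 3 ≤ p := fun α hα => (hmin α hα).1
  induction hn : l.length using Nat.strong_induction_on generalizing l with
  | _ n ih =>
    match l with
    | [] => exact absurd rfl hne
    | [x] =>
      have : Avoids Γ [x] := by
        intro i τ hτ h
        have h1 := h.1
        have h2 := hp τ hτ
        simp at h1
        omega
      simp [splitSum, clusterWeight, avoidWeight, this, wDes]
    | x :: y :: l =>
      have hl' : (y :: l).Nodup := hl.of_cons
      have h1 := ih _ (by simp [← hn]) hl' (by simp) rfl
      rw [splitSum_cons_cons hp, h1]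
      have hxy : x ≠ y := fun h => by simp [h] at hl
      have hz : -z * avoidWeight Γ z (y :: l) +
          (if x < y then (1 - z) * -avoidWeight Γ z (y :: l) else 0) =
          -((if y < x then z else 1) * avoidWeight Γ z (y :: l)) := by
        rcases lt_or_gt_of_ne hxy with h | h
        · rw [if_pos h, if_neg h.not_gt]
          ring
        · rw [if_neg h.not_gt, if_pos h]
          ring
      rw [hz]
      by_cases hex : ∃ α ∈ Γ, Pre α (x :: y :: l)
      · obtain ⟨α, hα, hpre⟩ := hex
        have huniq : ∀ β ∈ Γ, Pre β (x :: y :: l) ↔ β = α := by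
          intro β hβ
          constructor
          · intro h
            exact (eq_zero_and_eq_of_overlap hmin hmut hα hβ hl hpre (i := 0)
              (by have := hp α hα; omega) h).2.symm
          · rintro rfl
            exact hpre
        have hlen := hpre.1
        simp only [List.length_cons] at hlen
        have hp3 := hp α hα
        have h2 := ih _ (by simp [← hn])
          (hl'.sublist (List.drop_sublist (p - 2) (y :: l))) (by
            rw [Ne, List.drop_eq_nil_iff, List.length_cons]
            omega) rfl
        have hnot : ¬ Avoids Γ (x :: y :: l) := fun h => h 0 α hα hpre
        have h0 : avoidWeight Γ z (x :: y :: l) = 0 := by simp [avoidWeight, hnot]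
        rw [sum_congr rfl fun β hβ => by rw [if_congr (huniq β hβ) rfl rfl], sum_ite_eq' Γ α,
          if_pos hα, h2, h0, avoidWeight_of_pre hmin hmut z hα hl hpre]
        ring
      · have hnone : ∀ α ∈ Γ, ¬ Pre α (x :: y :: l) := fun α hα h => hex ⟨α, hα, h⟩
        rw [sum_eq_zero fun α hα => if_neg (hnone α hα), avoidWeight_cons z hnone, sub_zero]

/-! ### Sums over words weighted by inversions -/

/-- The sum of `q ^ wInv l * f l` over the words on `{0, …, n - 1}`. -/
def wordSum (q : K) (f : List ℕ → K) (n : ℕ) : K := ∑ l ∈ arr (range n), q ^ wInv l * f l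

theorem sum_arr_eq_wordSum (q : K) {f : List ℕ → K}
    (hf : ∀ φ : ℕ → ℕ, StrictMono φ → ∀ l, f (l.map φ) = f l) (S : Finset ℕ) :
    ∑ l ∈ arr S, q ^ wInv l * f l = wordSum q f #S :=
  sum_arr_eq_of_card (fun φ hφ l => by rw [wInv_map hφ, hf φ hφ]) S

theorem sum_arr_take_drop (q : K) (S : Finset ℕ) {k : ℕ} (hk : k ≤ #S)
    (H : List ℕ → List ℕ → K) :
    ∑ l ∈ arr S, q ^ wInv l * H (l.take k) (l.drop k) =
      ∑ A ∈ powersetCard k S, q ^ cross A (S \ A) *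
        ∑ u ∈ arr A, q ^ wInv u * ∑ v ∈ arr (S \ A), q ^ wInv v * H u v := by
  rw [sum_arr_split S hk]
  refine sum_congr rfl fun A hA => ?_
  rw [mul_sum]
  refine sum_congr rfl fun u hu => ?_
  rw [mul_sum, mul_sum]
  refine sum_congr rfl fun v hv => ?_
  have hlen : u.length = k := by rw [length_of_mem_arr hu, (mem_powersetCard.1 hA).2]
  rw [wInv_append_arr hu hv, ← hlen, List.take_left, List.drop_left, pow_add, pow_add]
  ring

theorem sum_arr_cons (q : K) {S : Finset ℕ} (hS : S.Nonempty) (H : List ℕ → K) :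
    ∑ l ∈ arr S, q ^ wInv l * H l =
      ∑ x ∈ S, q ^ #{b ∈ S \ {x} | b < x} *
        ∑ v ∈ arr (S \ {x}), q ^ wInv v * H (x :: v) := by
  have := sum_arr_take_drop q S (k := 1) (card_pos.2 hS) fun u v => H (u ++ v)
  simp only [List.take_append_drop] at this
  rw [this, powersetCard_one, sum_map]
  refine sum_congr rfl fun x _ => ?_
  simp [arr_singleton, cross, wInv]

/-- A first letter `x` of a word on `{0, …, n}` is the larger entry of `x` inversions, whence the
factor `[n + 1]_q`. -/
theorem sum_arr_pow_wInv (q : K) (S : Finset ℕ) :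
    ∑ l ∈ arr S, q ^ wInv l = qFactorial q #S := by
  induction hn : #S generalizing S with
  | zero =>
    rw [card_eq_zero.1 hn, arr_empty]
    simp [wInv, qFactorial]
  | succ n ih =>
    have h1 : ∑ l ∈ arr S, q ^ wInv l = ∑ l ∈ arr (range (n + 1)), q ^ wInv l * (1 : K) := by
      rw [← hn, sum_arr_eq_of_card fun φ hφ l => by rw [wInv_map hφ]]
      simp
    rw [h1, sum_arr_cons q (by simp), qFactorial, prod_range_succ, ← qFactorial, qNat, mul_sum]
    refine sum_congr rfl fun x hx => ?_
    have hx' : x < n + 1 := mem_range.1 hx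
    have h2 : ({b ∈ range (n + 1) \ {x} | b < x} : Finset ℕ) = range x := by
      ext b
      simp
      omega
    simp only [mul_one]
    rw [h2, card_range, ih (range (n + 1) \ {x}) (by
      rw [card_sdiff_of_subset (by simpa using hx'), card_range, card_singleton]
      rfl)]
    ring

/-- Cutting all words on `S` after `k` letters factors `[#S]_q!` as this sum times `[k]_q! [#S -
k]_q!`. -/
theorem sum_pow_cross {q : K} (hq : ∀ n, qFactorial q n ≠ 0) (S : Finset ℕ) (k : ℕ) :
    ∑ A ∈ powersetCard k S, q ^ cross A (S \ A) = qBinom q #S k := by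
  by_cases hk : k ≤ #S
  · rw [qBinom, if_pos hk, eq_div_iff (mul_ne_zero (hq _) (hq _)), ← sum_arr_pow_wInv q S, sum_mul]
    have := sum_arr_take_drop q S hk fun _ _ => 1
    simp only [mul_one] at this
    rw [this]
    refine sum_congr rfl fun A hA => ?_
    obtain ⟨hAS, hAk⟩ := mem_powersetCard.1 hA
    rw [← sum_mul, sum_arr_pow_wInv, sum_arr_pow_wInv, card_sdiff_of_subset hAS, hAk]
  · rw [powersetCard_eq_empty.2 (by omega), qBinom, if_neg hk, sum_empty]

theorem sum_arr_mul {q : K} (hq : ∀ n, qFactorial q n ≠ 0) {f g : List ℕ → K}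
    (hf : ∀ φ : ℕ → ℕ, StrictMono φ → ∀ l, f (l.map φ) = f l)
    (hg : ∀ φ : ℕ → ℕ, StrictMono φ → ∀ l, g (l.map φ) = g l) {n k : ℕ} (hk : k ≤ n) :
    ∑ l ∈ arr (range n), q ^ wInv l * (f (l.take k) * g (l.drop k)) =
      qBinom q n k * (wordSum q f k * wordSum q g (n - k)) := by
  have := sum_arr_take_drop q (range n) (k := k) (by simpa using hk) fun u v => f u * g v
  rw [this]
  have hb := sum_pow_cross hq (range n) k
  rw [card_range] at hb
  rw [← hb, sum_mul]
  refine sum_congr rfl fun A hA => ?_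
  obtain ⟨hAS, hAk⟩ := mem_powersetCard.1 hA
  have hc : #(range n \ A) = n - k := by rw [card_sdiff_of_subset hAS, hAk, card_range]
  rw [← hc, ← sum_arr_eq_wordSum q hg, ← hAk, ← sum_arr_eq_wordSum q hf, sum_mul]
  congr 1
  refine sum_congr rfl fun u _ => ?_
  rw [mul_sum, mul_sum]
  refine sum_congr rfl fun v _ => ?_
  ring

/-! ### The inverse of `INM` as the generating function of clusters -/

theorem wordSum_zero (q : K) (f : List ℕ → K) : wordSum q f 0 = f [] := by
  simp [wordSum, arr_empty, wInv]

theorem avoids_map {p : ℕ} (Γ : Finset (Equiv.Perm (Fin p))) {φ : ℕ → ℕ} (hφ : StrictMono φ)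
    (l : List ℕ) : Avoids Γ (l.map φ) ↔ Avoids Γ l := by
  simp only [Avoids, ← List.map_drop, pre_map _ hφ]

theorem avoidWeight_map {p : ℕ} (Γ : Finset (Equiv.Perm (Fin p))) (z : K) {φ : ℕ → ℕ}
    (hφ : StrictMono φ) (l : List ℕ) : avoidWeight Γ z (l.map φ) = avoidWeight Γ z l := by
  unfold avoidWeight
  simp only [wDes_map hφ, List.map_eq_nil_iff]
  rw [propext (avoids_map Γ hφ l)]

/-- The case `n = 0` is excluded because `INMcoeff` gives the empty permutation the weight `z`,
while `avoidWeight` gives the empty word the weight `1`. -/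
theorem INMcoeff_eq_wordSum {p : ℕ} {Γ : Finset (Equiv.Perm (Fin p))} (hp : ∀ α ∈ Γ, 3 ≤ p)
    (q z : K) {n : ℕ} (hn : n ≠ 0) : INMcoeff Γ q z n = wordSum q (avoidWeight Γ z) n := by
  rw [wordSum, ← sum_perm_eq_sum_arr, INMcoeff, NM, sum_filter]
  refine sum_congr rfl fun σ _ => ?_
  have hav : (∀ i : Fin n, ∀ τ ∈ Γ, ¬ IsMatch τ σ i) ↔ Avoids Γ (oneLine σ) := by
    simp only [isMatch_iff]
    constructor
    · intro h i τ hτ hpre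
      have h1 := hpre.1
      have h2 := hp τ hτ
      rw [List.length_drop, length_oneLine] at h1
      exact h ⟨i, by omega⟩ τ hτ hpre
    · exact fun h i => h i
  have hne : oneLine σ ≠ [] := by
    intro h
    have := length_oneLine σ
    rw [h] at this
    exact hn this.symm
  rw [avoidWeight, if_neg hne, inv_eq_wInv, des_eq_wDes]
  by_cases h : Avoids Γ (oneLine σ)
  · rw [if_pos (hav.2 h), if_pos h, mul_comm]
  · rw [if_neg (fun h' => h (hav.1 h')), if_neg h, mul_zero]

/-- The cluster sums are, up to `q`-factorials, the coefficients of the inverse of `INM`. -/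
theorem sum_qBinom_mul_wordSum {p : ℕ} {Γ : Finset (Equiv.Perm (Fin p))}
    (hmin : ∀ α ∈ Γ, MinimalOverlapping α)
    (hmut : ∀ α ∈ Γ, ∀ β ∈ Γ, α ≠ β → MutuallyMinimalOverlapping α β)
    {q : K} (hq : ∀ n, qFactorial q n ≠ 0) (z : K) {n : ℕ} (hn : n ≠ 0) :
    ∑ k ∈ range (n + 1), qBinom q n k *
      (wordSum q (clusterWeight Γ z) k * wordSum q (avoidWeight Γ z) (n - k)) = 0 := by
  have h1 : ∀ k ∈ range (n + 1), qBinom q n k *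
      (wordSum q (clusterWeight Γ z) k * wordSum q (avoidWeight Γ z) (n - k)) =
      ∑ l ∈ arr (range n), q ^ wInv l *
        (clusterWeight Γ z (l.take k) * avoidWeight Γ z (l.drop k)) := fun k hk =>
    (sum_arr_mul hq (fun _ hφ => clusterWeight_map Γ z hφ) (fun _ hφ => avoidWeight_map Γ z hφ)
      (by simpa [Nat.lt_succ_iff] using hk)).symm
  rw [sum_congr rfl h1, sum_comm]
  refine sum_eq_zero fun l hl => ?_
  have hlen : l.length = n := by simpa using length_of_mem_arr hl
  have hne : l ≠ [] := by
    rintro rfl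
    exact hn hlen.symm
  -- The term `k = 0` has the empty cluster and equals `avoidWeight Γ z l`; the others form
  -- `splitSum`.
  rw [← mul_sum, sum_range_succ']
  have := splitSum_eq hmin hmut z (mem_arr.1 hl).1 hne
  rw [splitSum, hlen] at this
  rw [this]
  simp [clusterWeight]

theorem qFactorial_zero (q : K) : qFactorial q 0 = 1 := by simp [qFactorial]

theorem qSeries_wordSum_mul_INM {p : ℕ} {Γ : Finset (Equiv.Perm (Fin p))}
    (hmin : ∀ α ∈ Γ, MinimalOverlapping α)
    (hmut : ∀ α ∈ Γ, ∀ β ∈ Γ, α ≠ β → MutuallyMinimalOverlapping α β)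
    {q : K} (hq : ∀ n, qFactorial q n ≠ 0) (z : K) :
    qSeries q (wordSum q (clusterWeight Γ z)) * INM Γ q z = 1 := by
  have hU : ∀ n, PowerSeries.coeff n (qSeries q (wordSum q (clusterWeight Γ z))) =
      wordSum q (clusterWeight Γ z) n / qFactorial q n := by
    intro n
    rw [qSeries, PowerSeries.coeff_mk]
    split_ifs with h
    · rw [h, wordSum_zero, qFactorial_zero, clusterWeight, div_one]
    · rfl
  have hA : ∀ n, PowerSeries.coeff n (INM Γ q z) =
      wordSum q (avoidWeight Γ z) n / qFactorial q n := by
    intro n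
    rw [INM, qSeries, PowerSeries.coeff_mk]
    split_ifs with h
    · rw [h, wordSum_zero, qFactorial_zero, avoidWeight, if_pos rfl, div_one]
    · rw [INMcoeff_eq_wordSum (fun α hα => (hmin α hα).1) q z h]
  ext n
  rw [PowerSeries.coeff_mul, Finset.Nat.sum_antidiagonal_eq_sum_range_succ_mk,
    PowerSeries.coeff_one]
  simp only [hU, hA]
  split_ifs with h
  · subst h
    simp [wordSum_zero, qFactorial_zero, clusterWeight, avoidWeight]
  · have h1 := sum_qBinom_mul_wordSum hmin hmut hq z h
    have h2 : ∀ k ∈ range (n + 1), qBinom q n k *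
        (wordSum q (clusterWeight Γ z) k * wordSum q (avoidWeight Γ z) (n - k)) =
        qFactorial q n * (wordSum q (clusterWeight Γ z) k / qFactorial q k *
          (wordSum q (avoidWeight Γ z) (n - k) / qFactorial q (n - k))) := by
      intro k hk
      have hk' : k ≤ n := by simpa [Nat.lt_succ_iff] using hk
      rw [qBinom, if_pos hk']
      have := hq k
      have := hq (n - k)
      field_simp
    rw [sum_congr rfl h2, ← mul_sum] at h1
    exact (mul_eq_zero.1 h1).resolve_left (hq n)

theorem constantCoeff_INM {p : ℕ} (Γ : Finset (Equiv.Perm (Fin p))) (q z : K) :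
    PowerSeries.constantCoeff (INM Γ q z) = 1 := by
  rw [← PowerSeries.coeff_zero_eq_constantCoeff_apply, INM, qSeries, PowerSeries.coeff_mk,
    if_pos rfl]

theorem IUcoeff_eq_wordSum {p : ℕ} {Γ : Finset (Equiv.Perm (Fin p))}
    (hmin : ∀ α ∈ Γ, MinimalOverlapping α)
    (hmut : ∀ α ∈ Γ, ∀ β ∈ Γ, α ≠ β → MutuallyMinimalOverlapping α β)
    {q : K} (hq : ∀ n, qFactorial q n ≠ 0) (z : K) {n : ℕ} (hn : n ≠ 0) :
    IUcoeff Γ q z n = wordSum q (clusterWeight Γ z) n := by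
  have h := (PowerSeries.eq_inv_iff_mul_eq_one (by rw [constantCoeff_INM]; exact one_ne_zero)).2
    (qSeries_wordSum_mul_INM hmin hmut hq z)
  rw [IUcoeff, ← h, qSeries, PowerSeries.coeff_mk, if_neg hn, mul_div_cancel₀ _ (hq n)]

theorem INM_mul_IU {p : ℕ} (Γ : Finset (Equiv.Perm (Fin p))) {q : K}
    (hq : ∀ n, qFactorial q n ≠ 0) (z : K) : INM Γ q z * IU Γ q z = 1 := by
  have : IU Γ q z = (INM Γ q z)⁻¹ := by
    ext n
    rw [IU, qSeries, PowerSeries.coeff_mk]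
    split_ifs with h
    · rw [h, PowerSeries.coeff_zero_eq_constantCoeff_apply, PowerSeries.constantCoeff_inv,
        constantCoeff_INM, inv_one]
    · rw [IUcoeff, mul_div_cancel_left₀ _ (hq n)]
  rw [this]
  exact PowerSeries.mul_inv_cancel _ (by rw [constantCoeff_INM]; exact one_ne_zero)

/-! ### The recursion for the cluster sums -/

/-- Among the words on `insert m T`, only those that start with the minimum `m` can have nonzero
weight, and `m` in front creates no inversion. -/
theorem sum_arr_clusterWeight_cons {p : ℕ} {Γ : Finset (Equiv.Perm (Fin p))}
    (hp : ∀ α ∈ Γ, 3 ≤ p) (hone : ∀ α ∈ Γ, StartsWithOne α) (q z : K) {m : ℕ} {T : Finset ℕ}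
    (hm : ∀ y ∈ T, m < y) :
    ∑ v ∈ arr T, q ^ wInv v * clusterWeight Γ z (m :: v) =
      wordSum q (clusterWeight Γ z) (#T + 1) := by
  have hmT : m ∉ T := fun h => lt_irrefl _ (hm m h)
  rw [← card_insert_of_notMem hmT, ← sum_arr_eq_wordSum q fun _ hφ => clusterWeight_map Γ z hφ,
    sum_arr_cons q (insert_nonempty m T), sum_eq_single m]
  · have h1 : insert m T \ {m} = T := by
      rw [sdiff_singleton_eq_erase, erase_insert hmT]
    have h2 : ({b ∈ T | b < m} : Finset ℕ) = ∅ :=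
      filter_eq_empty_iff.2 fun y hy => (hm y hy).not_gt
    rw [h1, h2, card_empty, pow_zero, one_mul]
  · intro x hx hxm
    have hx' : x ∈ T := (mem_insert.1 hx).resolve_left hxm
    rw [sum_eq_zero, mul_zero]
    intro v hv
    rw [mul_eq_zero]
    right
    by_contra h
    have hmv : m ∈ v := by
      rw [mem_iff_of_mem_arr hv]
      simp [Ne.symm hxm]
    exact absurd (head_lt_of_clusterWeight_ne_zero hp hone z h m hmv) (hm x hx').not_gt
  · simp

/-- The tail of a contributing word starts with its minimum, which exceeds the first letter; so the
first letter is `0` and is in no inversion. -/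
theorem sum_arr_ascent {p : ℕ} {Γ : Finset (Equiv.Perm (Fin p))}
    (hp : ∀ α ∈ Γ, 3 ≤ p) (hone : ∀ α ∈ Γ, StartsWithOne α) (q z : K) {n : ℕ} (hn : 2 ≤ n) :
    ∑ l ∈ arr (range n), q ^ wInv l *
      (if l.getD 0 0 < l.getD 1 0 then clusterWeight Γ z l.tail else 0) =
      wordSum q (clusterWeight Γ z) (n - 1) := by
  have hcard : #(range n \ {0}) = n - 1 := by
    rw [card_sdiff_of_subset (by simp; omega), card_range, card_singleton]
  have hlen : ∀ {x : ℕ} {v : List ℕ}, x ∈ range n → v ∈ arr (range n \ {x}) →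
      ∃ y v', v = y :: v' := by
    intro x v hx hv
    have := length_of_mem_arr hv
    rw [card_sdiff_of_subset (by simpa using hx), card_range, card_singleton] at this
    exact List.exists_cons_of_length_pos (by omega)
  rw [sum_arr_cons q (by simp; omega), sum_eq_single 0]
  · rw [← hcard, ← sum_arr_eq_wordSum q fun _ hφ => clusterWeight_map Γ z hφ]
    simp only [Nat.not_lt_zero, filter_false, card_empty, pow_zero, one_mul]
    refine sum_congr rfl fun v hv => ?_
    obtain ⟨y, v', rfl⟩ := hlen (by simp; omega) hv
    have hy : y ∈ range n \ {0} := (mem_iff_of_mem_arr hv).1 (by simp)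
    have hy0 : 0 < y := by
      simp at hy
      omega
    simp [hy0]
  · intro x hx hx0
    rw [sum_eq_zero, mul_zero]
    intro v hv
    obtain ⟨y, v', rfl⟩ := hlen hx hv
    rw [mul_eq_zero]
    right
    refine ite_eq_right_iff.2 fun hxy => ?_
    by_contra h
    have h0 : 0 ∈ y :: v' := by
      rw [mem_iff_of_mem_arr hv]
      simp [Ne.symm hx0]
      omega
    have hxy' : x < y := by simpa using hxy
    rcases List.mem_cons.1 h0 with h0 | h0
    · omega
    · have := head_lt_of_clusterWeight_ne_zero hp hone z h 0 h0
      omega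
  · intro h
    exact absurd (mem_range.2 (by omega)) h

theorem sum_arr_pre {M : Type*} [AddCommMonoid M] {p : ℕ} (α : Equiv.Perm (Fin p))
    {φ : ℕ → ℕ} (hφ : StrictMono φ) (F : List ℕ → M) :
    ∑ u ∈ arr ((range p).image φ), (if Pre α u then F u else 0) = F ((oneLine α).map φ) := by
  rw [sum_arr_image hφ, ← sum_perm_eq_sum_arr]
  simp_rw [pre_map α hφ, pre_oneLine_iff]
  simp

/-- Here `φ` lists the letters of a match in increasing order and `φ s` is its last letter. Both
sides express that no letter up to `φ s` is missing from the match, so that `φ s = s`. -/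
theorem forall_sdiff_lt_iff {n p s : ℕ} {φ : ℕ → ℕ} (hφ : StrictMono φ) (hs : s < p)
    (hA : (range p).image φ ⊆ range n) :
    (∀ y ∈ range n \ (range p).image φ, φ s < y) ↔ range (s + 1) ⊆ (range p).image φ := by
  constructor
  · intro h y hy
    by_contra hyA
    have hsn : φ s < n := mem_range.1 (hA (mem_image_of_mem _ (mem_range.2 hs)))
    have hys := mem_range.1 hy
    have h1 := hφ.le_apply (x := s)
    have := h y (mem_sdiff.2 ⟨mem_range.2 (by omega), hyA⟩)
    omega
  · intro h y hy
    have hle : φ s ≤ s := by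
      by_contra hlt
      -- If `s < φ s`, the `s + 1` letters up to `s` would all be values of `φ` at indices below
      -- `s`, against the pigeonhole principle.
      have hsub : range (s + 1) ⊆ (range s).image φ := by
        intro i hi
        obtain ⟨j, _, rfl⟩ := mem_image.1 (h hi)
        have hi' := mem_range.1 hi
        have : j < s := hφ.lt_iff_lt.1 (by omega)
        exact mem_image_of_mem _ (mem_range.2 this)
      have := (card_le_card hsub).trans card_image_le
      simp at this
    have : ¬ y < s + 1 := fun hy' => (mem_sdiff.1 hy).2 (h (mem_range.2 hy'))
    omega

/-- The forced letters lie below every letter outside `A` and add nothing to `cross`; the other `p -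
s` letters are chosen freely from `Ico s n`. -/
theorem sum_pow_cross_range_subset {q : K} (hq : ∀ n, qFactorial q n ≠ 0) {n p s : ℕ}
    (hs : s ≤ p) (hpn : p ≤ n) :
    ∑ A ∈ powersetCard p (range n), (if range s ⊆ A then q ^ cross A (range n \ A) else 0) =
      qBinom q (n - s) (p - s) := by
  have := sum_pow_cross hq (Ico s n) (p - s)
  rw [Nat.card_Ico] at this
  rw [← this, ← sum_filter]
  have hdisj : ∀ {B : Finset ℕ}, B ⊆ Ico s n → Disjoint (range s) B := by
    intro B hB
    rw [disjoint_left]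
    intro x hx hx'
    have h1 := mem_range.1 hx
    have h2 := mem_Ico.1 (hB hx')
    omega
  refine sum_nbij' (fun A => A \ range s) (fun B => range s ∪ B) ?_ ?_ ?_ ?_ ?_
  · intro A hA
    obtain ⟨hA, hsA⟩ := mem_filter.1 hA
    obtain ⟨hAn, hAp⟩ := mem_powersetCard.1 hA
    refine mem_powersetCard.2 ⟨?_, ?_⟩
    · intro x hx
      obtain ⟨h1, h2⟩ := mem_sdiff.1 hx
      have h3 := mem_range.1 (hAn h1)
      rw [mem_range] at h2
      exact mem_Ico.2 ⟨by omega, h3⟩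
    · rw [card_sdiff_of_subset hsA, hAp, card_range]
  · intro B hB
    obtain ⟨hBn, hBp⟩ := mem_powersetCard.1 hB
    refine mem_filter.2 ⟨mem_powersetCard.2 ⟨?_, ?_⟩, subset_union_left⟩
    · refine union_subset (range_subset_range.2 (hs.trans hpn)) fun x hx => ?_
      exact mem_range.2 (mem_Ico.1 (hBn hx)).2
    · rw [card_union_of_disjoint (hdisj hBn), hBp, card_range]
      omega
  · intro A hA
    exact union_sdiff_of_subset (mem_filter.1 hA).2
  · intro B hB
    exact union_sdiff_cancel_left (hdisj (mem_powersetCard.1 hB).1)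
  · intro A hA
    obtain ⟨hA, hsA⟩ := mem_filter.1 hA
    obtain ⟨hAn, hAp⟩ := mem_powersetCard.1 hA
    have hcompl : Ico s n \ (A \ range s) = range n \ A := by
      ext x
      simp only [mem_sdiff, mem_Ico, mem_range]
      have : x < s → x ∈ A := fun h => hsA (mem_range.2 h)
      by_cases hx : x ∈ A
      · simp only [hx, true_and, not_true, and_false, iff_false]
        omega
      · have : ¬ x < s := fun h => hx (this h)
        simp only [hx, false_and, not_false_iff, and_true]
        omega
    congr 1
    rw [hcompl, cross, cross, ← sum_sdiff hsA]
    refine (add_eq_left.2 (sum_eq_zero fun a ha => ?_))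
    rw [card_eq_zero, filter_eq_empty_iff]
    intro b hb hba
    exact (mem_sdiff.1 hb).2 (hsA (mem_range.2 (hba.trans (mem_range.1 ha))))

/-- The words are grouped by the set `A` of their first `p` letters, whose arrangement is dictated
by `α`. What follows, together with the last letter `φ s` of the match, is a cluster on `n - p + 1`
letters; it can only have nonzero weight if `φ s` is its minimum, that is, if `A` contains `0, …,
s`. -/
theorem sum_arr_match {p : ℕ} {Γ : Finset (Equiv.Perm (Fin p))}
    (hp : ∀ α ∈ Γ, 3 ≤ p) (hone : ∀ α ∈ Γ, StartsWithOne α) {q : K}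
    (hq : ∀ n, qFactorial q n ≠ 0) (z : K) {n : ℕ} (hpn : p ≤ n)
    {α : Equiv.Perm (Fin p)} (hα : α ∈ Γ) :
    ∑ l ∈ arr (range n), q ^ wInv l *
      (if Pre α l then clusterWeight Γ z (l.drop (p - 1)) else 0) =
      q ^ inv α * qBinom q (n - lastLetter α) (p - lastLetter α) *
        wordSum q (clusterWeight Γ z) (n - p + 1) := by
  have hp3 := hp α hα
  have hlast : lastLetter α = (α ⟨p - 1, by omega⟩ : ℕ) + 1 := by
    rw [lastLetter, dif_pos (by omega)]
  set s : ℕ := (α ⟨p - 1, by omega⟩ : ℕ) with hs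
  have hsp : s < p := (α ⟨p - 1, by omega⟩).2
  have hsplit : ∀ l ∈ arr (range n), q ^ wInv l *
      (if Pre α l then clusterWeight Γ z (l.drop (p - 1)) else 0) =
      q ^ wInv l * (if Pre α (l.take p) then
        clusterWeight Γ z ((l.take p).drop (p - 1) ++ l.drop p) else 0) := by
    intro l hl
    have hlen : l.length = n := by simpa using length_of_mem_arr hl
    have h1 : Pre α (l.take p) ↔ Pre α l := by
      rw [pre_take]
      simp
    have h2 : (l.take p).drop (p - 1) ++ l.drop p = l.drop (p - 1) := by
      rw [← List.drop_append_of_le_length (by rw [List.length_take]; omega),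
        List.take_append_drop]
    simp only [h1, h2]
  rw [sum_congr rfl hsplit, sum_arr_take_drop q (range n) (by simpa using hpn) fun u v =>
    if Pre α u then clusterWeight Γ z (u.drop (p - 1) ++ v) else 0]
  have hA : ∀ A ∈ powersetCard p (range n), q ^ cross A (range n \ A) *
      ∑ u ∈ arr A, q ^ wInv u * ∑ v ∈ arr (range n \ A), q ^ wInv v *
        (if Pre α u then clusterWeight Γ z (u.drop (p - 1) ++ v) else 0) =
      (if range (s + 1) ⊆ A then q ^ cross A (range n \ A) else 0) *
        (q ^ inv α * wordSum q (clusterWeight Γ z) (n - p + 1)) := by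
    intro A hA
    obtain ⟨hAn, hAp⟩ := mem_powersetCard.1 hA
    have hcard : #(range n \ A) = n - p := by rw [card_sdiff_of_subset hAn, hAp, card_range]
    obtain ⟨φ, hφ, hAφ⟩ := exists_strictMono_image A
    rw [hAp] at hAφ
    have h1 : ∀ u ∈ arr A, q ^ wInv u * ∑ v ∈ arr (range n \ A), q ^ wInv v *
        (if Pre α u then clusterWeight Γ z (u.drop (p - 1) ++ v) else 0) =
        if Pre α u then q ^ wInv u * ∑ v ∈ arr (range n \ A), q ^ wInv v *
          clusterWeight Γ z (u.drop (p - 1) ++ v) else 0 := by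
      intro u _
      split_ifs <;> simp
    have h2 : ((oneLine α).map φ).drop (p - 1) = [φ s] := by
      have hlt : p - 1 < ((oneLine α).map φ).length := by
        rw [List.length_map, length_oneLine]
        omega
      rw [List.drop_eq_getElem_cons hlt, List.drop_eq_nil_of_le (by
        rw [List.length_map, length_oneLine]
        omega)]
      simp [oneLine, hs]
    have h3 := sum_arr_pre α hφ fun u => q ^ wInv u * ∑ v ∈ arr (range n \ A), q ^ wInv v *
      clusterWeight Γ z (u.drop (p - 1) ++ v)
    rw [← hAφ] at h3
    rw [sum_congr rfl h1, h3, wInv_map hφ, ← inv_eq_wInv, h2]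
    simp only [List.singleton_append]
    have hiff := forall_sdiff_lt_iff (n := n) hφ hsp (by rwa [← hAφ])
    rw [← hAφ] at hiff
    split_ifs with hsub
    · rw [sum_arr_clusterWeight_cons hp hone q z (hiff.2 hsub), hcard]
    · have h4 : ∑ v ∈ arr (range n \ A), q ^ wInv v * clusterWeight Γ z (φ s :: v) = 0 := by
        refine sum_eq_zero fun v hv => ?_
        rw [mul_eq_zero]
        right
        by_contra h
        refine hsub (hiff.1 fun y hy => ?_)
        exact head_lt_of_clusterWeight_ne_zero hp hone z h y ((mem_iff_of_mem_arr hv).2 hy)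
      rw [h4]
      ring
  rw [sum_congr rfl hA, ← sum_mul, sum_pow_cross_range_subset hq (by omega) hpn, hlast]
  ring

theorem wordSum_clusterWeight_one {p : ℕ} (Γ : Finset (Equiv.Perm (Fin p))) (q z : K) :
    wordSum q (clusterWeight Γ z) 1 = -z := by
  rw [wordSum, range_one, arr_singleton, sum_singleton, clusterWeight]
  simp [wInv]

theorem wordSum_clusterWeight_rec {p : ℕ} {Γ : Finset (Equiv.Perm (Fin p))}
    (hp : ∀ α ∈ Γ, 3 ≤ p) (hone : ∀ α ∈ Γ, StartsWithOne α) {q : K}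
    (hq : ∀ n, qFactorial q n ≠ 0) (z : K) {n : ℕ} (hn : 2 ≤ n) :
    wordSum q (clusterWeight Γ z) n = (1 - z) * wordSum q (clusterWeight Γ z) (n - 1) -
      if p ≤ n then
        ∑ α ∈ Γ, z ^ des α * q ^ inv α * qBinom q (n - lastLetter α) (p - lastLetter α) *
          wordSum q (clusterWeight Γ z) (n - p + 1)
      else 0 := by
  have hrec : ∀ l ∈ arr (range n), q ^ wInv l * clusterWeight Γ z l =
      (1 - z) * (q ^ wInv l *
        (if l.getD 0 0 < l.getD 1 0 then clusterWeight Γ z l.tail else 0)) -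
      ∑ α ∈ Γ, z ^ des α * (q ^ wInv l *
        (if Pre α l then clusterWeight Γ z (l.drop (p - 1)) else 0)) := by
    intro l hl
    have hlen : l.length = n := by simpa using length_of_mem_arr hl
    match l with
    | [] => simp at hlen; omega
    | [x] => simp at hlen; omega
    | x :: y :: l =>
      rw [clusterWeight, mul_sub, mul_sum]
      congr 1
      · simp only [List.getD_cons_zero, List.getD_cons_succ, List.tail_cons]
        split_ifs <;> ring
      · refine sum_congr rfl fun α hα => ?_
        have hp3 := hp α hα
        have : (x :: y :: l).drop (p - 1) = (y :: l).drop (p - 2) := by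
          rw [show p - 1 = p - 2 + 1 by omega, List.drop_succ_cons]
        rw [this]
        split_ifs <;> ring
  rw [wordSum, sum_congr rfl hrec, sum_sub_distrib, ← mul_sum, sum_arr_ascent hp hone q z hn,
    sum_comm]
  congr 1
  split_ifs with hpn
  · refine sum_congr rfl fun α hα => ?_
    rw [← mul_sum, sum_arr_match hp hone hq z hpn hα]
    ring
  · refine sum_eq_zero fun α _ => sum_eq_zero fun l hl => ?_
    have hlen : l.length = n := by simpa using length_of_mem_arr hl
    rw [if_neg fun h : Pre α l => hpn (hlen ▸ h.1)]
    ring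

theorem qFactorial_qVar_ne_zero (n : ℕ) : qFactorial qVar n ≠ 0 := by
  refine prod_ne_zero_iff.2 fun m _ h => ?_
  have h1 : algebraMap (MvPolynomial (Fin 2) ℚ) RatQZ
      (∑ i ∈ range (m + 1), MvPolynomial.X 0 ^ i) = 0 := by
    rw [← h, qNat, map_sum]
    simp only [map_pow, qVar]
  have h2 := (IsFractionRing.to_map_eq_zero_iff (K := RatQZ)).1 h1
  -- At `q = 1` the polynomial `[m + 1]_q` takes the value `m + 1`, which is nonzero in `ℚ`.
  have h3 := congrArg (MvPolynomial.eval fun _ => (1 : ℚ)) h2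
  simp only [map_sum, map_pow, MvPolynomial.eval_X, one_pow, sum_const, card_range, map_zero,
    nsmul_eq_mul, mul_one] at h3
  exact Nat.succ_ne_zero m (Nat.cast_eq_zero.1 h3)

end ConsecutivePattern

open ConsecutivePattern in
/-- In the recursion, the sum over `Γ` is absent for `n < p`, where its `q`-binomial coefficients
vanish by convention. -/
theorem theorem5p2 (p : ℕ) (Γ : Finset (Equiv.Perm (Fin p)))
    (hmin : ∀ α ∈ Γ, MinimalOverlapping α)
    (hone : ∀ α ∈ Γ, StartsWithOne α)
    (hmut : ∀ α ∈ Γ, ∀ β ∈ Γ, α ≠ β → MutuallyMinimalOverlapping α β) :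
    INM Γ qVar zVar * IU Γ qVar zVar = 1 ∧
    IUcoeff Γ qVar zVar 1 = -zVar ∧
    ∀ n : ℕ, 2 ≤ n →
      IUcoeff Γ qVar zVar n =
        (1 - zVar) * IUcoeff Γ qVar zVar (n - 1) -
          if p ≤ n then
            ∑ α ∈ Γ, zVar ^ des α * qVar ^ inv α *
              qBinom qVar (n - lastLetter α) (p - lastLetter α) *
              IUcoeff Γ qVar zVar (n - p + 1)
          else 0 := by
  have hU : ∀ {n : ℕ}, n ≠ 0 →
      IUcoeff Γ qVar zVar n = wordSum qVar (clusterWeight Γ zVar) n := fun hn =>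
    IUcoeff_eq_wordSum hmin hmut qFactorial_qVar_ne_zero zVar hn
  refine ⟨INM_mul_IU Γ qFactorial_qVar_ne_zero zVar, ?_, fun n hn => ?_⟩
  · rw [hU one_ne_zero, wordSum_clusterWeight_one]
  · rw [hU (by omega), hU (by omega), hU (by omega)]
    exact wordSum_clusterWeight_rec (fun α hα => (hmin α hα).1) hone qFactorial_qVar_ne_zero zVar hn
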